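/- An oriented graph $G=(V,E)$ is a directed graph without loops, multiple arcs or digons. A substructure $G'=(V',E')$ of $G$ consists of finite sets $V'\subseteq V$ and $E'\subseteq E$; arcs in $E'$ may have endpoints outside $V'$. For $\omega\in\mathbb{C}$ with $|\omega|=1$, its Hermitian Laplacian $L_\omega(G')$ is the $V'\times V'$ matrix whose diagonal entry at $u$ is the number of arcs of $E'$ incident to $u$ and whose entry at $(u,v)$, $u\neq v$, is $-\omega$ if $(u\to v)\in E'$, $-\overline{\omega}$ if $(v\to u)\in E'$, and $0$ otherwise. Two vertices of $V'$ are connected if they are joined by a path, ignoring directions, with all its vertices in $V'$ and all its arcs in $E'$. A connected component of $G'$ is a substructure $(V'_i,E'_i)$ where $V'_i$ is a class of mutually connected vertices of $V'$ and $E'_i$ is the set of arcs of $E'$ incident to at least one vertex of $V'_i$. $G'$ is all-regular if $|V'_i|=|E'_i|$ for every connected component. A component is a unicyclic graph if all its arcs have both endpoints in $V'_i$ and it contains exactly one (undirected) cycle. For a positive integer $p$, a unicyclic graph is $p$-vanishing if $p\mid k-2g$, and non-$p$-vanishing otherwise, where $k$ is the length of its cycle and $g$ is the number of negative arcs of the cycle,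 i.e. of arcs pointing against the direction around the cycle in which the majority of its arcs point (if there is a tie, either direction may be chosen, and $g=k/2$). **Theorem.** Let $p$ be an odd prime, and for $q\in\{1,\dots,(p-1)/2\}$ let $\omega_{p/q}=e^{2\pi i/(p/q)}$. Let $G'$ be an all-regular substructure of an oriented graph none of whose connected components is a $p$-vanishing unicyclic graph, and let $n_*$ be the number of connected components of $G'$ that are (non-$p$-vanishing) unicyclic graphs. Then $$\prod_{q=1}^{(p-1)/2}\det L_{\omega_{p/q}}(G')=p^{n_*},\qquad\text{equivalently}\qquad n_*=\log_p\left(\prod_{q=1}^{(p-1)/2}\det L_{\omega_{p/q}}(G')\right).$$ -/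

import Mathlib

/-- An oriented graph: arcs `u → v`, at most one per ordered pair, without loops and without
digons. -/
structure OrientedGraph (V : Type*) extends Digraph V where
  loopless : ∀ u, ¬ Adj u u
  noDigon : ∀ u v, Adj u v → ¬ Adj v u

/-- A substructure `(V', E')` of an oriented graph: a finite set `V'` of vertices and a finite set
`E'` of arcs. The arc `u → v` is the pair `(u, v)`; its endpoints need not lie in `V'`. -/
structure Substructure {V : Type*} (G : OrientedGraph V) where
  verts : Finset V
  edges : Finset (V × V)
  edges_adj : ∀ e ∈ edges, G.Adj e.1 e.2

namespace Substructure

variable {V : Type*} {G : OrientedGraph V}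

/-- The number of arcs of `E'` incident to `u`. -/
def deg [DecidableEq V] (H : Substructure G) (u : V) : ℕ :=
  (H.edges.filter (fun e => e.1 = u ∨ e.2 = u)).card

/-- The Hermitian Laplacian matrix `L_ω(G')`, indexed by the vertices in `V'`. -/
noncomputable def laplacian [DecidableEq V] (H : Substructure G) (ω : ℂ) :
    Matrix H.verts H.verts ℂ :=
  Matrix.of fun u v =>
    if u = v then (H.deg u : ℂ)
    else if ((u : V), (v : V)) ∈ H.edges then -ω
    else if ((v : V), (u : V)) ∈ H.edges then -(starRingEnd ℂ ω)
    else 0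

/-- The undirected graph on `V'` in which two vertices of `V'` are adjacent if an arc of `E'` joins
them, in either direction. -/
def graph (H : Substructure G) : SimpleGraph H.verts where
  Adj u v := ((u : V), (v : V)) ∈ H.edges ∨ ((v : V), (u : V)) ∈ H.edges
  symm := ⟨fun _ _ h => h.symm⟩
  loopless := ⟨fun u h => G.loopless u (H.edges_adj _ (h.elim id id))⟩

open Classical in
/-- The connected component of a substructure belonging to a class `c` of mutually connected
vertices of `V'`: the vertices of `c`, and the arcs of `E'` incident to at least one of them. -/
noncomputable def component (H : Substructure G) (c : H.graph.ConnectedComponent) :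
    Substructure G where
  verts := H.verts.filter (fun v => ∃ h : v ∈ H.verts, (⟨v, h⟩ : H.verts) ∈ c.supp)
  edges := H.edges.filter (fun e =>
    ∃ x : H.verts, x ∈ c.supp ∧ (e.1 = (x : V) ∨ e.2 = (x : V)))
  edges_adj := fun e he => H.edges_adj e (Finset.mem_filter.mp he).1

/-- A regular substructure: `|V'| = |E'|`. -/
def IsRegular (H : Substructure G) : Prop :=
  H.verts.card = H.edges.card

/-- An all-regular substructure: all its connected components are regular. -/
def IsAllRegular (H : Substructure G) : Prop :=
  ∀ c : H.graph.ConnectedComponent, (H.component c).IsRegular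

/-- A substructure that is a graph: the endpoints of all its arcs are among its vertices. -/
def IsSubgraph (H : Substructure G) : Prop :=
  ∀ e ∈ H.edges, e.1 ∈ H.verts ∧ e.2 ∈ H.verts

/-- A unicyclic graph: a connected graph that contains exactly one cycle. A cycle is regarded as a
subgraph, so that its starting point and the sense in which it is traversed do not matter. -/
def IsUnicyclic (H : Substructure G) : Prop :=
  H.IsSubgraph ∧ H.graph.Connected ∧
    ∃! C : H.graph.Subgraph,
      ∃ (v : H.verts) (w : H.graph.Walk v v), w.IsCycle ∧ w.toSubgraph = C

open Classical in
/-- The number of steps of a walk that follow the direction of the arc they use. -/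
noncomputable def numForward (H : Substructure G) {u v : H.verts} (w : H.graph.Walk u v) : ℕ :=
  w.darts.countP (fun d => ((d.fst : V), (d.snd : V)) ∈ H.edges)

open Classical in
/-- The number of steps of a walk that go against the direction of the arc they use. -/
noncomputable def numBackward (H : Substructure G) {u v : H.verts} (w : H.graph.Walk u v) : ℕ :=
  w.darts.countP (fun d => ((d.snd : V), (d.fst : V)) ∈ H.edges)

/-- The number `g` of negative edges of a cycle, whose positive direction is the one in which the
majority of its arcs point. -/
noncomputable def numNegative (H : Substructure G) {v : H.verts} (w : H.graph.Walk v v) : ℕ :=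
  min (H.numForward w) (H.numBackward w)

/-- A `p`-vanishing unicyclic graph: `p ∣ k - 2g`, where `k` is the length of its cycle and `g` is
the number of negative edges of its cycle. -/
def IsVanishingUnicyclic (p : ℕ) (H : Substructure G) : Prop :=
  H.IsUnicyclic ∧ ∃ (v : H.verts) (w : H.graph.Walk v v), w.IsCycle ∧
    (p : ℤ) ∣ (w.length : ℤ) - 2 * (H.numNegative w : ℤ)

/-- A non-`p`-vanishing unicyclic graph: `p ∤ k - 2g`, with `k` and `g` as above. -/
def IsNonVanishingUnicyclic (p : ℕ) (H : Substructure G) : Prop :=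
  H.IsUnicyclic ∧ ∃ (v : H.verts) (w : H.graph.Walk v v), w.IsCycle ∧
    ¬ (p : ℤ) ∣ (w.length : ℤ) - 2 * (H.numNegative w : ℤ)

/-- The number of connected components that are non-`p`-vanishing unicyclic graphs. -/
noncomputable def numNonVanishing (p : ℕ) (H : Substructure G) : ℕ :=
  {c : H.graph.ConnectedComponent | (H.component c).IsNonVanishingUnicyclic p}.ncard

end Substructure

/-- `ω_r = e^{2πi/r}`. -/
noncomputable def omegaRoot (r : ℝ) : ℂ :=
  Complex.exp (Complex.I * 2 * Real.pi / r)

/-!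
The proof reads the determinant off one connected component at a time: the Hermitian Laplacian is
block diagonal with respect to the components (`Substructure.det_laplacian_eq_prod_component`).

A connected component with as many arcs as vertices consists of a spanning tree `T` and one further
arc, of which at least one end lies in the component. The Laplacian is `S Sᴴ` for the square
incidence matrix `S`, so its determinant is `|det S|²`. On the tree there is an integer potential
`h` that increases by `1` along every arc; multiplying the row of `u` by `ω ^ h u` and the columns
by suitable phases turns the tree columns into those of the ordinary incidence matrix of `T`.
Completed by a unit vector, these form an integer matrix that is invertible over `ℤ`, because `T`
is connected (`isUnit_of_connected_of_col`), so its determinant is `±1`. The same invertibility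
provides the potential. What remains of `|det S|` is the absolute value of the sum of the
entries of the column of the further arc (`Substructure.exists_potential_det_laplacian`).

If that arc leaves the component, this sum has one term, of absolute value `1`, and the determinant
is `1`. If it is an arc `a → b` inside the component, the sum has absolute value `|1 - ω ^ n|` with
`n = h a + 1 - h b`. In that case the component is a unicyclic graph. Its cycle passes
through `a → b` exactly once, so that, up to sign, `n` is the difference between its numbers of
forward and of backward arcs, that is, `|n| = k - 2g`
(`Substructure.det_laplacian_of_connected`).

Finally `∏ |1 - ω_{p/q} ^ n|²` over `1 ≤ q ≤ (p - 1) / 2` is the product of `1 - ζ` over all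
primitive `p`-th roots of unity `ζ` if `p ∤ n`, which is `p` (`prod_omegaRoot`).
-/

open scoped Matrix

/-! ### Graphs with as many edges as vertices -/

/-- A connected finite graph with as many edges as vertices contains exactly one cycle. Two cycles
have the same edges: deleting an edge of one of them leaves a connected graph with one edge less
than vertices, that is, a tree, and a tree cannot contain the other cycle. -/
theorem SimpleGraph.Connected.existsUnique_isCycle_toSubgraph {ι : Type*} [Finite ι]
    {Γ : SimpleGraph ι} (hΓ : Γ.Connected) (hcard : Nat.card Γ.edgeSet = Nat.card ι) :
    ∃! C : Γ.Subgraph, ∃ (v : ι) (w : Γ.Walk v v), w.IsCycle ∧ w.toSubgraph = C := by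
  have hsub : ∀ {v₁ v₂ : ι} (w₁ : Γ.Walk v₁ v₁) (w₂ : Γ.Walk v₂ v₂), w₁.IsCycle → w₂.IsCycle →
      ∀ e ∈ w₁.edges, e ∈ w₂.edges := by
    intro v₁ v₂ w₁ w₂ h₁ h₂ e he
    by_contra he₂
    have heΓ : e ∈ Γ.edgeSet := w₁.edges_subset_edgeSet he
    have hb : ¬ Γ.IsBridge e := fun hb => hb.notMem_edges_of_isCycle h₁ he
    have htree : (Γ.deleteEdges {e}).IsTree := by
      rw [SimpleGraph.isTree_iff_connected_and_card]
      constructor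
      · induction e with
        | h x y => exact hΓ.connected_delete_edge_of_not_isBridge hb
      · rw [← hcard, SimpleGraph.edgeSet_deleteEdges, Nat.card_coe_set_eq, Nat.card_coe_set_eq]
        exact Set.ncard_sdiff_singleton_add_one heΓ
    refine htree.isAcyclic (w₂.transfer _ ?_) (h₂.transfer _)
    intro f hf
    rw [SimpleGraph.edgeSet_deleteEdges]
    exact ⟨w₂.edges_subset_edgeSet hf, fun h => he₂ (h ▸ hf)⟩
  have hex : ∃ (v : ι) (w : Γ.Walk v v), w.IsCycle := by
    by_contra! hno
    have := (SimpleGraph.isTree_iff_connected_and_card.mp ⟨hΓ, fun v w => hno v w⟩).2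
    omega
  obtain ⟨v, w, hw⟩ := hex
  refine ⟨w.toSubgraph, ⟨v, w, hw, rfl⟩, ?_⟩
  rintro _ ⟨v', w', hw', rfl⟩
  have hE : ∀ e, e ∈ w'.edges ↔ e ∈ w.edges :=
    fun e => ⟨hsub w' w hw' hw e, hsub w w' hw hw' e⟩
  refine SimpleGraph.Subgraph.ext (Set.ext fun x => ?_) (funext fun x => funext fun y => ?_)
  · rw [SimpleGraph.Walk.mem_verts_toSubgraph, SimpleGraph.Walk.mem_verts_toSubgraph,
      SimpleGraph.Walk.mem_support_iff_exists_mem_edges_of_not_nil hw'.not_nil,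
      SimpleGraph.Walk.mem_support_iff_exists_mem_edges_of_not_nil hw.not_nil]
    simp only [hE]
  · simp only [SimpleGraph.Walk.adj_toSubgraph_iff_mem_edges, hE]

/-! ### Reduced incidence matrices -/

/-- An integer matrix whose columns contain, up to sign, the difference `e_u - e_v` for every edge
`uv` of a connected graph, and which has `e_r` as a column, is invertible over the integers: every
`e_v` is an integer combination of its columns, along a path from `r` to `v`. -/
theorem isUnit_of_connected_of_col {ι : Type*} [Fintype ι] [DecidableEq ι] {T : SimpleGraph ι}
    (hT : T.Connected) (N : Matrix ι ι ℤ) {r : ι} (hr : N.col r = Pi.single r 1)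
    (hN : ∀ u v, T.Adj u v → ∃ e, N.col e = Pi.single u 1 - Pi.single v 1 ∨
      N.col e = Pi.single v 1 - Pi.single u 1) :
    IsUnit N := by
  rw [← Matrix.mulVec_surjective_iff_isUnit]
  have hcol : ∀ e, N.col e ∈ LinearMap.range N.mulVecLin := fun e =>
    ⟨Pi.single e 1, by simp⟩
  have hstep : ∀ u v, T.Adj u v → Pi.single u (1 : ℤ) ∈ LinearMap.range N.mulVecLin →
      Pi.single v (1 : ℤ) ∈ LinearMap.range N.mulVecLin := by
    intro u v huv hu
    obtain ⟨e, he | he⟩ := hN u v huv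
    · simpa [he] using Submodule.sub_mem _ hu (hcol e)
    · simpa [he] using Submodule.add_mem _ hu (hcol e)
  have hwalk : ∀ {u v} (_ : T.Walk u v), Pi.single u (1 : ℤ) ∈ LinearMap.range N.mulVecLin →
      Pi.single v (1 : ℤ) ∈ LinearMap.range N.mulVecLin := by
    intro u v w
    induction w with
    | nil => exact id
    | cons h _ ih => exact fun hu => ih (hstep _ _ h hu)
  have hall : ∀ v, Pi.single v (1 : ℤ) ∈ LinearMap.range N.mulVecLin := fun v =>
    hwalk (hT.preconnected r v).some (hr ▸ hcol r)
  intro y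
  have hy : y ∈ LinearMap.range N.mulVecLin := by
    rw [pi_eq_sum_univ' y]
    refine Submodule.sum_mem _ fun v _ => ?_
    have := Submodule.smul_mem _ (y v) (hall v)
    convert this using 1
  obtain ⟨x, hx⟩ := hy
  exact ⟨x, hx⟩

/-- If all columns of `N` other than the column `r` sum to `0`, and the column `r` sums to `1`,
then replacing the column `r` by `s` multiplies the determinant by the sum of the entries of `s`. -/
theorem det_updateCol_eq_det_mul_sum {ι R : Type*} [Fintype ι] [DecidableEq ι] [CommRing R]
    (N : Matrix ι ι R) (hN : IsUnit N) (r : ι) (hsum : ∀ e, ∑ u, N u e = if e = r then 1 else 0)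
    (s : ι → R) : (N.updateCol r s).det = N.det * ∑ u, s u := by
  obtain ⟨x, rfl⟩ := Matrix.mulVec_surjective_iff_isUnit.mpr hN s
  have hx : ∑ u, (N *ᵥ x) u = x r := by
    simp only [Matrix.mulVec, dotProduct]
    rw [Finset.sum_comm]
    simp [← Finset.sum_mul, hsum]
  rw [hx, ← Matrix.cramer_apply, Matrix.cramer_eq_adjugate_mulVec, Matrix.mulVec_mulVec,
    Matrix.adjugate_mul]
  simp [Matrix.smul_mulVec]

/-! ### Roots of unity -/

/-- The values `1 - μ ^ k` for `1 ≤ k ≤ 2m` multiply to `2m + 1`, the value at `1` of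
`1 + X + ⋯ + X ^ (2m)`; the exponents `q` and `2m + 1 - q` are paired here. -/
theorem IsPrimitiveRoot.prod_one_sub_mul_one_sub_inv {m : ℕ} {μ : ℂ}
    (hμ : IsPrimitiveRoot μ (2 * m + 1)) :
    ∏ q ∈ Finset.Icc 1 m, (1 - μ ^ q) * (1 - (μ ^ q)⁻¹) = (2 * m + 1 : ℕ) := by
  have h := hμ.prod_one_sub_pow_eq_order
  rw [two_mul, Finset.prod_range_add, ← Finset.prod_range_reflect (fun x => 1 - μ ^ (m + x + 1)),
    ← Finset.prod_mul_distrib] at h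
  rw [← Finset.Ico_add_one_right_eq_Icc, Finset.prod_Ico_eq_prod_range, two_mul]
  push_cast at h ⊢
  rw [← h]
  refine Finset.prod_congr (by simp) fun k hk => ?_
  have hk' : k < m := by simpa using hk
  rw [add_comm 1 k]
  congr 2
  refine inv_eq_of_mul_eq_one_right ?_
  rw [← pow_add, ← hμ.pow_eq_one]
  congr 1
  omega

/-! ### The incidence matrix and potentials on a spanning tree -/

namespace Substructure

variable {V : Type*} {G : OrientedGraph V}

/-- The incidence matrix of a substructure: the column of an arc has the entry `ω` at its tail and
`-1` at its head, as far as these belong to `V'`. -/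
def incidence [DecidableEq V] (H : Substructure G) (ω : ℂ) : Matrix H.verts H.edges ℂ :=
  Matrix.of fun u e =>
    (if (e : V × V).1 = u then ω else 0) - (if (e : V × V).2 = u then 1 else 0)

theorem laplacian_eq_incidence_mul_conjTranspose [DecidableEq V] (H : Substructure G) {ω : ℂ}
    (hω : ‖ω‖ = 1) : H.laplacian ω = H.incidence ω * (H.incidence ω)ᴴ := by
  have hωω : ω * starRingEnd ℂ ω = 1 := by simp [Complex.mul_conj, Complex.normSq_eq_norm_sq, hω]
  ext u v
  rw [Matrix.mul_apply]
  simp only [Matrix.conjTranspose_apply, incidence, Matrix.of_apply, laplacian]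
  rw [Finset.sum_coe_sort H.edges (fun e : V × V =>
    ((if e.1 = u then ω else 0) - (if e.2 = u then 1 else 0)) *
      star ((if e.1 = (v : V) then ω else 0) - (if e.2 = v then 1 else 0)))]
  by_cases huv : u = v
  · subst huv
    rw [if_pos rfl, deg, Finset.card_filter, Nat.cast_sum]
    refine Finset.sum_congr rfl fun e he => ?_
    have hl : e.1 ≠ e.2 := fun h => G.loopless e.1 (by simpa [← h] using H.edges_adj e he)
    by_cases h1 : e.1 = u
    · have h2 : e.2 ≠ u := fun h => hl (h1.trans h.symm)
      simp [h1, h2, hωω]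
    · by_cases h2 : e.2 = u <;> simp [h1, h2]
  · have huv' : (u : V) ≠ v := fun h => huv (Subtype.ext h)
    rw [if_neg huv]
    have hterm : ∀ e ∈ H.edges,
        ((if e.1 = u then ω else 0) - (if e.2 = u then 1 else 0)) *
          star ((if e.1 = (v : V) then ω else 0) - (if e.2 = v then 1 else 0)) =
        (if e = ((u : V), (v : V)) then -ω else 0) +
          (if e = ((v : V), (u : V)) then -(starRingEnd ℂ ω) else 0) := by
      rintro ⟨x, y⟩ he
      have hl : x ≠ y := fun h => G.loopless x (by simpa [← h] using H.edges_adj _ he)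
      simp only [Prod.mk.injEq]
      by_cases hxu : x = u
      · have hxv : x ≠ v := fun h => huv' (hxu.symm.trans h)
        have hyu : y ≠ u := fun h => hl (hxu.trans h.symm)
        by_cases hyv : y = v <;> (simp [*]; try grind)
      · by_cases hxv : x = v
        · have hyv : y ≠ v := fun h => hl (hxv.trans h.symm)
          by_cases hyu : y = u <;> simp [*] <;> grind
        · by_cases hyu : y = u
          · have hyv : y ≠ v := fun h => huv' (hyu.symm.trans h)
            simp [*]
          · simp [*]
    rw [Finset.sum_congr rfl hterm, Finset.sum_add_distrib, Finset.sum_ite_eq', Finset.sum_ite_eq']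
    by_cases h1 : ((u : V), (v : V)) ∈ H.edges
    · have h2 : ((v : V), (u : V)) ∉ H.edges :=
        fun h => G.noDigon _ _ (H.edges_adj _ h1) (H.edges_adj _ h)
      simp [h1, h2]
    · simp [h1]

open Classical in
/-- The arcs of a substructure that lie on the edges of a graph on its vertices. -/
noncomputable def arcsOn (H : Substructure G) (T : SimpleGraph H.verts) : Finset (V × V) :=
  H.edges.filter fun e => ∃ u v : H.verts, T.Adj u v ∧ e = ((u : V), (v : V))

theorem mem_arcsOn {H : Substructure G} {T : SimpleGraph H.verts} {e : V × V} :
    e ∈ H.arcsOn T ↔ e ∈ H.edges ∧ ∃ u v : H.verts, T.Adj u v ∧ e = ((u : V), (v : V)) := by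
  simp [arcsOn]

/-- As there are no digons, the arcs on the edges of `T` correspond to these edges. -/
theorem card_arcsOn (H : Substructure G) {T : SimpleGraph H.verts} (hT : T ≤ H.graph) :
    (H.arcsOn T).card = Nat.card T.edgeSet := by
  have himage : (fun e : V × V => s(e.1, e.2)) '' (H.arcsOn T : Set (V × V)) =
      Sym2.map Subtype.val '' T.edgeSet := by
    ext z
    constructor
    · rintro ⟨e, he, rfl⟩
      obtain ⟨-, u, v, huv, rfl⟩ := mem_arcsOn.mp he
      exact ⟨s(u, v), huv, rfl⟩
    · rintro ⟨f, hf, rfl⟩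
      induction f with
      | h u v =>
        rcases hT hf with h | h
        · exact ⟨(u, v), mem_arcsOn.mpr ⟨h, u, v, hf, rfl⟩, rfl⟩
        · exact ⟨(v, u), mem_arcsOn.mpr ⟨h, v, u, hf.symm, rfl⟩, Sym2.eq_swap⟩
  have hinj : Set.InjOn (fun e : V × V => s(e.1, e.2)) (H.arcsOn T : Set (V × V)) := by
    rintro ⟨x, y⟩ he ⟨x', y'⟩ he' h
    rcases Sym2.eq_iff.mp h with ⟨h₁, h₂⟩ | ⟨h₁, h₂⟩
    · exact Prod.ext h₁ h₂
    · simp only at h₁ h₂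
      subst h₁ h₂
      exact (G.noDigon _ _ (H.edges_adj _ (mem_arcsOn.mp he).1)
        (H.edges_adj _ (mem_arcsOn.mp he').1)).elim
  rw [Nat.card_coe_set_eq, ← Set.ncard_image_of_injective _ (Sym2.map.injective
    Subtype.val_injective), ← himage, hinj.ncard_image, Set.ncard_coe_finset]

/-- Let the arcs be numbered by the vertices, such that all arcs but the one with number `r` lie
on the spanning tree `T`. There is a potential `h` that increases by `1` along the arcs of the
tree. Multiplying the row `u` of the incidence matrix by `ω ^ h u` turns the columns of the tree,
up to phases, into columns of the ordinary incidence matrix, which has a unimodular reduction. So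
only the sum of the remaining column counts. -/
theorem exists_potential_det_laplacian [DecidableEq V] (H : Substructure G)
    {T : SimpleGraph H.verts} (hT : T.Connected) (hTH : T ≤ H.graph) (r : H.verts)
    (σ : H.verts ≃ H.edges) (hσ : ∀ e, e ≠ r ↔ (σ e : V × V) ∈ H.arcsOn T) :
    ∃ h : H.verts → ℤ,
      (∀ u v, T.Adj u v → ((u : V), (v : V)) ∈ H.edges → h v = h u + 1) ∧
      ∀ ω : ℂ, ‖ω‖ = 1 → (H.laplacian ω).det =
        (Complex.normSq (∑ u, ω ^ h u * H.incidence ω u (σ r)) : ℂ) := by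
  set N : Matrix H.verts H.verts ℤ := Matrix.of fun u e =>
    if e = r then (Pi.single r 1 : H.verts → ℤ) u
    else (if (σ e : V × V).1 = u then 1 else 0) - (if (σ e : V × V).2 = u then 1 else 0) with hNdef
  have hends : ∀ e, e ≠ r → ∃ u v : H.verts, T.Adj u v ∧ (σ e : V × V) = ((u : V), (v : V)) :=
    fun e he => (mem_arcsOn.mp ((hσ e).mp he)).2
  have hcol : ∀ e, e ≠ r → ∀ u v : H.verts, (σ e : V × V) = ((u : V), (v : V)) →
      N.col e = Pi.single u 1 - Pi.single v 1 := by
    intro e he u v huv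
    ext x
    have hsingle : ∀ c : H.verts,
        (Pi.single c 1 : H.verts → ℤ) x = if (c : V) = x then 1 else 0 := fun c => by
      rw [Pi.single_apply]
      exact if_congr (by rw [Subtype.ext_iff, eq_comm]) rfl rfl
    simp [hNdef, he, huv, hsingle]
  have harc : ∀ u v, T.Adj u v → ((u : V), (v : V)) ∈ H.edges →
      ∃ e, e ≠ r ∧ (σ e : V × V) = ((u : V), (v : V)) := by
    intro u v huv he
    have hs : (σ (σ.symm ⟨((u : V), (v : V)), he⟩) : V × V) = ((u : V), (v : V)) := by simp
    exact ⟨_, (hσ _).mpr (by rw [hs]; exact mem_arcsOn.mpr ⟨he, u, v, huv, rfl⟩), hs⟩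
  have hr : N.col r = Pi.single r 1 := by
    ext x
    simp [hNdef]
  have hN : IsUnit N := by
    refine isUnit_of_connected_of_col hT N hr fun u v huv => ?_
    rcases hTH huv with he | he
    · obtain ⟨e, her, hσe⟩ := harc u v huv he
      exact ⟨e, Or.inl (hcol e her u v hσe)⟩
    · obtain ⟨e, her, hσe⟩ := harc v u huv.symm he
      exact ⟨e, Or.inr (hcol e her v u hσe)⟩
  -- For the column of a tree arc `u → v` this reads `h u - h v = -1`; at `r` it is irrelevant.
  obtain ⟨h, hh⟩ := Matrix.vecMul_surjective_iff_isUnit.mpr hN (fun _ => -1)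
  have hpot : ∀ e, e ≠ r → ∀ u v : H.verts, (σ e : V × V) = ((u : V), (v : V)) →
      h v = h u + 1 := by
    intro e he u v huv
    have h1 : h ⬝ᵥ N.col e = -1 := congrFun hh e
    rw [hcol e he u v huv, dotProduct_sub, dotProduct_single, dotProduct_single] at h1
    linarith
  refine ⟨h, fun u v huv he => ?_, fun ω hω => ?_⟩
  · obtain ⟨e, her, hσe⟩ := harc u v huv he
    exact hpot e her u v hσe
  have hω0 : ω ≠ 0 := by
    rintro rfl
    simp at hω
  set S : Matrix H.verts H.verts ℂ := (H.incidence ω).submatrix id σ with hS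
  set s : H.verts → ℂ := fun u => ω ^ h u * H.incidence ω u (σ r) with hs
  have hL : (H.laplacian ω).det = (Complex.normSq S.det : ℂ) := by
    rw [laplacian_eq_incidence_mul_conjTranspose H hω, ← Complex.mul_conj]
    have : H.incidence ω * (H.incidence ω)ᴴ = S * Sᴴ := by
      rw [hS, Matrix.conjTranspose_submatrix, Matrix.submatrix_mul_equiv, Matrix.submatrix_id_id]
    rw [this, Matrix.det_mul, Matrix.det_conjTranspose]
    rfl
  have hphase : ∀ e, ∃ z : ℂ, ‖z‖ = 1 ∧ ∀ u, ω ^ h u * S u e * z =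
      ((N.map (Int.castRingHom ℂ)).updateCol r s) u e := by
    intro e
    by_cases he : e = r
    · subst he
      exact ⟨1, by simp, fun u => by simp [hs, hS]⟩
    · obtain ⟨a, b, -, hab⟩ := hends e he
      have hb := hpot e he a b hab
      refine ⟨(ω ^ h b)⁻¹, by simp [hω], fun u => ?_⟩
      rw [Matrix.updateCol_ne he, Matrix.map_apply]
      have hNu : N u e = (if (a : V) = u then 1 else 0) - (if (b : V) = u then 1 else 0) := by
        simp [hNdef, he, hab]
      have hSu : S u e = (if (a : V) = u then ω else 0) - (if (b : V) = u then 1 else 0) := by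
        simp [hS, incidence, hab]
      have hz : ω ^ h b ≠ 0 := zpow_ne_zero _ hω0
      rw [hNu, hSu, mul_inv_eq_iff_eq_mul₀ hz]
      by_cases hau : (a : V) = u
      · have hau' : a = u := Subtype.ext hau
        by_cases hbu : (b : V) = u
        · have hbu' : b = u := Subtype.ext hbu
          rw [hau', hbu'] at hb
          omega
        · simp [hau, hbu, hb, ← hau', zpow_add_one₀ hω0]
      · by_cases hbu : (b : V) = u
        · have hbu' : b = u := Subtype.ext hbu
          simp [hau, hbu, ← hbu']
        · simp [hau, hbu]
  choose z hz1 hz using hphase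
  have hmat : Matrix.diagonal (fun u => ω ^ h u) * S * Matrix.diagonal z =
      (N.map (Int.castRingHom ℂ)).updateCol r s := by
    ext u e
    rw [Matrix.mul_diagonal, Matrix.diagonal_mul, hz]
  have hNC : IsUnit (N.map (Int.castRingHom ℂ)) := hN.map (Int.castRingHom ℂ).mapMatrix
  have hsum : ∀ e, ∑ u, (N.map (Int.castRingHom ℂ)) u e = if e = r then 1 else 0 := by
    intro e
    have : ∑ u, N.col e u = if e = r then 1 else 0 := by
      by_cases he : e = r
      · subst he
        rw [hr]
        simp [-Finset.univ_eq_attach]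
      · obtain ⟨a, b, -, hab⟩ := hends e he
        rw [hcol e he a b hab]
        simp [he, -Finset.univ_eq_attach]
    have h2 := congrArg (Int.castRingHom ℂ) this
    rw [map_sum] at h2
    simp only [Matrix.map_apply]
    exact h2.trans (by split_ifs <;> simp)
  have hdet := congrArg norm (congrArg Matrix.det hmat)
  rw [det_updateCol_eq_det_mul_sum _ hNC r hsum, Matrix.det_mul, Matrix.det_mul,
    Matrix.det_diagonal, Matrix.det_diagonal, norm_mul, norm_mul, norm_mul, norm_prod,
    norm_prod] at hdet
  have hNdet : ‖(N.map (Int.castRingHom ℂ)).det‖ = 1 := by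
    have h1 : (N.map (Int.castRingHom ℂ)).det = (N.det : ℂ) :=
      ((Int.castRingHom ℂ).map_det N).symm
    rw [h1]
    rcases Int.isUnit_iff.mp ((Matrix.isUnit_iff_isUnit_det N).mp hN) with h2 | h2 <;> simp [h2]
  simp only [norm_zpow, hω, one_zpow, hz1, Finset.prod_const_one, one_mul, mul_one,
    hNdet] at hdet
  rw [hL, Complex.normSq_eq_norm_sq, Complex.normSq_eq_norm_sq, hdet]

end Substructure

/-! ### Forward and backward steps of a cycle -/

namespace Substructure

variable {V : Type*} {G : OrientedGraph V}

theorem numForward_add_numBackward (H : Substructure G) {u v : H.verts} (w : H.graph.Walk u v) :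
    H.numForward w + H.numBackward w = w.length := by
  classical
  induction w with
  | nil => simp [numForward, numBackward]
  | @cons a b c hab w ih =>
    simp only [numForward, numBackward, SimpleGraph.Walk.darts_cons, List.countP_cons,
      SimpleGraph.Walk.length_cons, decide_eq_true_eq] at ih ⊢
    rcases hab with h | h
    · have h' : ((b : V), (a : V)) ∉ H.edges :=
        fun h' => G.noDigon _ _ (H.edges_adj _ h) (H.edges_adj _ h')
      simp only [h, h', if_true, if_false]
      omega
    · have h' : ((a : V), (b : V)) ∉ H.edges :=
        fun h' => G.noDigon _ _ (H.edges_adj _ h) (H.edges_adj _ h')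
      simp only [h, h', if_true, if_false]
      omega

/-- `k - 2 min(f, b) = |f - b|` when `k = f + b`. -/
theorem length_sub_two_mul_numNegative (H : Substructure G) {v : H.verts} (w : H.graph.Walk v v) :
    (w.length : ℤ) - 2 * (H.numNegative w : ℤ) =
      |(H.numForward w : ℤ) - (H.numBackward w : ℤ)| := by
  have h := H.numForward_add_numBackward w
  rw [numNegative]
  rcases le_total (H.numForward w) (H.numBackward w) with h' | h'
  · rw [min_eq_left h', abs_of_nonpos (by omega)]
    omega
  · rw [min_eq_right h', abs_of_nonneg (by omega)]
    omega

open Classical in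
/-- If `h` increases by `1` along all arcs except `a → b`, where it increases by `1 - n`, then the
excess of forward over backward steps of a walk is the increase of `h`, plus `n` times the signed
number of passages through `a → b`. -/
theorem numForward_sub_numBackward (H : Substructure G) {h : H.verts → ℤ} {a b : H.verts}
    (hE : ((a : V), (b : V)) ∈ H.edges)
    (hh : ∀ u v : H.verts, ((u : V), (v : V)) ∈ H.edges → ¬ (u = a ∧ v = b) → h v = h u + 1)
    {u v : H.verts} (w : H.graph.Walk u v) :
    (H.numForward w : ℤ) - (H.numBackward w : ℤ) = h v - h u + (h a + 1 - h b) *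
      ((w.darts.countP (fun d => d.fst = a ∧ d.snd = b) : ℤ) -
        (w.darts.countP (fun d => d.fst = b ∧ d.snd = a) : ℤ)) := by
  induction w with
  | nil => simp [numForward, numBackward]
  | @cons x y c hxy w ih =>
    simp only [numForward, numBackward, SimpleGraph.Walk.darts_cons, List.countP_cons,
      decide_eq_true_eq] at ih ⊢
    have key : ((if ((x : V), (y : V)) ∈ H.edges then 1 else 0 : ℕ) : ℤ) -
        ((if ((y : V), (x : V)) ∈ H.edges then 1 else 0 : ℕ) : ℤ) = h y - h x +
          (h a + 1 - h b) * (((if x = a ∧ y = b then 1 else 0 : ℕ) : ℤ) -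
            ((if x = b ∧ y = a then 1 else 0 : ℕ) : ℤ)) := by
      rcases hxy with he | he
      · have he' : ((y : V), (x : V)) ∉ H.edges :=
          fun h' => G.noDigon _ _ (H.edges_adj _ he) (H.edges_adj _ h')
        have hba : ¬ (x = b ∧ y = a) := by
          rintro ⟨rfl, rfl⟩
          exact he' hE
        by_cases hab : x = a ∧ y = b
        · obtain ⟨rfl, rfl⟩ := hab
          simp [he, he', hba]
        · simp [he, he', hba, hab, hh x y he hab]
      · have he' : ((x : V), (y : V)) ∉ H.edges :=
          fun h' => G.noDigon _ _ (H.edges_adj _ he) (H.edges_adj _ h')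
        have hab : ¬ (x = a ∧ y = b) := by
          rintro ⟨rfl, rfl⟩
          exact he' hE
        by_cases hba : x = b ∧ y = a
        · obtain ⟨rfl, rfl⟩ := hba
          simp [he, he', hab]
        · simp [he, he', hba, hab, hh y x he fun h' => hba h'.symm]
    push_cast at key ih ⊢
    linear_combination ih + key

theorem countP_dart_add_countP_dart {ι : Type*} [DecidableEq ι] {Γ : SimpleGraph ι} {a b : ι}
    (hab : a ≠ b) {u v : ι} (w : Γ.Walk u v) :
    w.darts.countP (fun d => d.fst = a ∧ d.snd = b) +
      w.darts.countP (fun d => d.fst = b ∧ d.snd = a) = w.edges.count s(a, b) := by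
  induction w with
  | nil => simp
  | @cons x y c hxy w ih =>
    simp only [SimpleGraph.Walk.darts_cons, List.countP_cons, SimpleGraph.Walk.edges_cons,
      List.count_cons, ← ih, decide_eq_true_eq, beq_iff_eq, Sym2.eq_iff]
    by_cases h1 : x = a ∧ y = b
    · have h2 : ¬ (x = b ∧ y = a) := fun h => hab (h1.1.symm.trans h.1)
      simp only [if_pos h1, if_neg h2, if_pos (Or.inl h1)]
      omega
    · by_cases h2 : x = b ∧ y = a
      · simp only [if_neg h1, if_pos h2, if_pos (Or.inr h2)]
        omega
      · simp only [h1, h2, or_self, if_false]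
        omega

/-- If `h` is a potential as above and a cycle uses the edge `ab`, hence uses it exactly once,
then `k - 2g = |n|` for this cycle. -/
theorem length_sub_two_mul_numNegative_of_isCycle (H : Substructure G) {h : H.verts → ℤ}
    {a b : H.verts} (hE : ((a : V), (b : V)) ∈ H.edges)
    (hh : ∀ u v : H.verts, ((u : V), (v : V)) ∈ H.edges → ¬ (u = a ∧ v = b) → h v = h u + 1)
    {v : H.verts} (w : H.graph.Walk v v) (hw : w.IsCycle) (hab : s(a, b) ∈ w.edges) :
    (w.length : ℤ) - 2 * (H.numNegative w : ℤ) = |h a + 1 - h b| := by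
  classical
  have hne : a ≠ b := ((SimpleGraph.mem_edgeSet _).mp (w.edges_subset_edgeSet hab)).ne
  have hcount := countP_dart_add_countP_dart hne w
  rw [List.count_eq_one_of_mem hw.edges_nodup hab] at hcount
  rw [length_sub_two_mul_numNegative, H.numForward_sub_numBackward hE hh w, sub_self,
    zero_add, abs_mul]
  rcases Nat.add_eq_one_iff.mp hcount with ⟨h1, h2⟩ | ⟨h1, h2⟩ <;> rw [h1, h2] <;> simp

/-! ### The determinant of a connected regular substructure -/

/-- A connected regular substructure is a tree with one further arc. If that arc leaves `V'`, the
Hermitian Laplacian has determinant `1`. Otherwise the substructure is a unicyclic graph, and the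
determinant is `|1 - ω^n|²`, where `|n| = k - 2g` for its cycle: `n` is the defect along the
further arc of the potential of the tree. -/
theorem det_laplacian_of_connected [DecidableEq V] (H : Substructure G) (hconn : H.graph.Connected)
    (hreg : H.IsRegular) (hinc : ∀ e ∈ H.edges, e.1 ∈ H.verts ∨ e.2 ∈ H.verts) :
    (¬ H.IsUnicyclic ∧ ∀ ω : ℂ, ‖ω‖ = 1 → (H.laplacian ω).det = 1) ∨
    (H.IsUnicyclic ∧ ∃ n : ℤ,
      (∀ (v : H.verts) (w : H.graph.Walk v v), w.IsCycle →
        (w.length : ℤ) - 2 * (H.numNegative w : ℤ) = |n|) ∧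
      ∀ ω : ℂ, ‖ω‖ = 1 → (H.laplacian ω).det = (1 - ω ^ n) * (1 - (ω ^ n)⁻¹)) := by
  obtain ⟨T, hTH, hT⟩ := hconn.exists_isTree_le
  have hTcard : (H.arcsOn T).card + 1 = H.edges.card := by
    rw [H.card_arcsOn hTH, (SimpleGraph.isTree_iff_connected_and_card.mp hT).2, ← hreg,
      Nat.card_eq_fintype_card, Fintype.card_coe]
  have hTsub : H.arcsOn T ⊆ H.edges := fun e he => (mem_arcsOn.mp he).1
  obtain ⟨e₀, he₀⟩ : ∃ e₀, H.edges \ H.arcsOn T = {e₀} := by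
    rw [← Finset.card_eq_one, Finset.card_sdiff_of_subset hTsub]
    omega
  have hmem : ∀ e, e ∈ H.edges ∧ e ∉ H.arcsOn T ↔ e = e₀ := by
    intro e
    rw [← Finset.mem_sdiff, he₀, Finset.mem_singleton]
  have he₀E : e₀ ∈ H.edges := ((hmem e₀).mpr rfl).1
  have he₀T : e₀ ∉ H.arcsOn T := ((hmem e₀).mpr rfl).2
  obtain ⟨r⟩ := hconn.nonempty
  obtain ⟨σ, hσr⟩ : ∃ σ : H.verts ≃ H.edges, σ r = ⟨e₀, he₀E⟩ := by
    have τ : H.verts ≃ H.edges := Finset.equivOfCardEq hreg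
    exact ⟨τ.trans (Equiv.swap (τ r) ⟨e₀, he₀E⟩), by simp⟩
  have hσ : ∀ e, e ≠ r ↔ (σ e : V × V) ∈ H.arcsOn T := by
    intro e
    rw [← not_iff_not, not_not, ← σ.injective.eq_iff, hσr, Subtype.ext_iff, ← hmem]
    simp
  obtain ⟨h, hpot, hdet⟩ := H.exists_potential_det_laplacian hT.connected hTH r σ hσ
  have hsum : ∀ ω : ℂ, ∑ u, ω ^ h u * H.incidence ω u (σ r) =
      ∑ u : H.verts, ((if e₀.1 = u then ω ^ h u * ω else 0) -
        if e₀.2 = u then ω ^ h u else 0) := by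
    intro ω
    refine Finset.sum_congr rfl fun u _ => ?_
    simp [incidence, hσr, mul_sub]
  have hdiff : e₀.1 ≠ e₀.2 := fun he =>
    G.loopless e₀.1 (by simpa [← he] using H.edges_adj e₀ he₀E)
  obtain ⟨x, y⟩ := e₀
  simp only at hdiff hsum
  have hsingle : ∀ (c : H.verts) (f : H.verts → ℂ),
      (∑ u : H.verts, if (c : V) = u then f u else 0) = f c := by
    intro c f
    simp
  have hnone : ∀ (c : V) (f : H.verts → ℂ), c ∉ H.verts →
      (∑ u : H.verts, if c = (u : V) then f u else 0) = 0 := by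
    intro c f hc
    refine Finset.sum_eq_zero fun u _ => if_neg ?_
    rintro rfl
    exact hc u.2
  simp only [Finset.sum_sub_distrib] at hsum
  by_cases hx : x ∈ H.verts
  · by_cases hy : y ∈ H.verts
    · right
      obtain ⟨a, rfl⟩ : ∃ a : H.verts, (a : V) = x := ⟨⟨x, hx⟩, rfl⟩
      obtain ⟨b, rfl⟩ : ∃ b : H.verts, (b : V) = y := ⟨⟨y, hy⟩, rfl⟩
      have hsubgraph : H.IsSubgraph := by
        intro e he
        by_cases heT : e ∈ H.arcsOn T
        · obtain ⟨-, u, v, -, rfl⟩ := mem_arcsOn.mp heT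
          exact ⟨u.2, v.2⟩
        · obtain rfl := (hmem e).mp ⟨he, heT⟩
          exact ⟨hx, hy⟩
      have hall : H.arcsOn H.graph = H.edges := by
        refine Finset.Subset.antisymm (fun e he => (mem_arcsOn.mp he).1) fun e he => ?_
        exact mem_arcsOn.mpr ⟨he, ⟨e.1, (hsubgraph e he).1⟩, ⟨e.2, (hsubgraph e he).2⟩,
          Or.inl he, rfl⟩
      refine ⟨⟨hsubgraph, hconn, hconn.existsUnique_isCycle_toSubgraph ?_⟩, h a + 1 - h b,
        fun v w hw => ?_, fun ω hω => ?_⟩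
      · rw [← H.card_arcsOn le_rfl, hall, ← hreg, Nat.card_eq_fintype_card, Fintype.card_coe]
      · have hh : ∀ u v : H.verts, ((u : V), (v : V)) ∈ H.edges → ¬ (u = a ∧ v = b) →
            h v = h u + 1 := by
          intro u v he huv
          have heT : ((u : V), (v : V)) ∈ H.arcsOn T := by
            by_contra heT
            have := (hmem _).mp ⟨he, heT⟩
            exact huv ⟨Subtype.ext (congrArg Prod.fst this), Subtype.ext (congrArg Prod.snd this)⟩
          obtain ⟨-, u', v', huv', heq⟩ := mem_arcsOn.mp heT
          obtain rfl : u = u' := Subtype.ext (congrArg Prod.fst heq)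
          obtain rfl : v = v' := Subtype.ext (congrArg Prod.snd heq)
          exact hpot u v huv' he
        -- The tree contains no cycle, so the cycle uses the edge `ab`.
        have hmem_w : s(a, b) ∈ w.edges := by
          by_contra hno
          refine hT.isAcyclic (w.transfer T fun f hf => ?_) (hw.transfer _)
          have hfH := w.edges_subset_edgeSet hf
          induction f with
          | h u v =>
            have harc : ∀ u v : H.verts, ((u : V), (v : V)) ∈ H.edges → s(u, v) ∈ w.edges →
                T.Adj u v := by
              intro u v he hf
              have heT : ((u : V), (v : V)) ∈ H.arcsOn T := by
                by_contra heT
                have := (hmem _).mp ⟨he, heT⟩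
                obtain rfl : u = a := Subtype.ext (congrArg Prod.fst this)
                obtain rfl : v = b := Subtype.ext (congrArg Prod.snd this)
                exact hno hf
              obtain ⟨-, u', v', huv', heq⟩ := mem_arcsOn.mp heT
              obtain rfl : u = u' := Subtype.ext (congrArg Prod.fst heq)
              obtain rfl : v = v' := Subtype.ext (congrArg Prod.snd heq)
              exact huv'
            rcases hfH with he | he
            · exact harc u v he hf
            · exact (harc v u he (Sym2.eq_swap ▸ hf)).symm
        exact H.length_sub_two_mul_numNegative_of_isCycle he₀E hh w hw hmem_w
      · have hω0 : ω ≠ 0 := by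
          rintro rfl
          simp at hω
        have hn : ‖ω ^ (h a + 1 - h b)‖ = 1 := by simp [hω]
        have hfac : ω ^ h a * ω - ω ^ h b = -ω ^ h b * (1 - ω ^ (h a + 1 - h b)) := by
          rw [zpow_sub₀ hω0, zpow_add_one₀ hω0]
          field_simp
          ring
        rw [hdet ω hω, hsum, hsingle a fun u => ω ^ h u * ω, hsingle b fun u => ω ^ h u, hfac,
          map_mul, Complex.normSq_eq_norm_sq, norm_neg, norm_zpow, hω, ← Complex.inv_eq_conj hn |>.symm]
        rw [one_zpow, one_pow, one_mul, ← Complex.mul_conj, map_sub, map_one]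
    · left
      obtain ⟨a, rfl⟩ : ∃ a : H.verts, (a : V) = x := ⟨⟨x, hx⟩, rfl⟩
      refine ⟨fun hU => hy (hU.1 _ he₀E).2, fun ω hω => ?_⟩
      rw [hdet ω hω, hsum, hsingle a fun u => ω ^ h u * ω, hnone y _ hy]
      simp [Complex.normSq_eq_norm_sq, hω]
  · left
    obtain ⟨b, rfl⟩ : ∃ b : H.verts, (b : V) = y :=
      ⟨⟨y, (hinc _ he₀E).resolve_left hx⟩, rfl⟩
    refine ⟨fun hU => hx (hU.1 _ he₀E).1, fun ω hω => ?_⟩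
    rw [hdet ω hω, hsum, hsingle b fun u => ω ^ h u, hnone x _ hx]
    simp [Complex.normSq_eq_norm_sq, hω]

end Substructure

/-! ### Decomposition into components -/

namespace Substructure

variable {V : Type*} {G : OrientedGraph V}

theorem mem_component_verts {H : Substructure G} {c : H.graph.ConnectedComponent} {v : V} :
    v ∈ (H.component c).verts ↔ ∃ h : v ∈ H.verts, (⟨v, h⟩ : H.verts) ∈ c.supp := by
  simp only [component, Finset.mem_filter]
  exact ⟨fun h => h.2, fun h => ⟨h.1, h⟩⟩

theorem mem_component_edges {H : Substructure G} {c : H.graph.ConnectedComponent} {e : V × V} :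
    e ∈ (H.component c).edges ↔
      e ∈ H.edges ∧ ∃ x : H.verts, x ∈ c.supp ∧ (e.1 = (x : V) ∨ e.2 = (x : V)) := by
  simp only [component, Finset.mem_filter]

/-- The vertices of a component, as vertices of the whole substructure. -/
noncomputable def componentVertsEquiv (H : Substructure G) (c : H.graph.ConnectedComponent) :
    {v : H.verts // v ∈ c.supp} ≃ (H.component c).verts where
  toFun v := ⟨v.1, mem_component_verts.mpr ⟨v.1.2, v.2⟩⟩
  invFun v := ⟨⟨v.1, (mem_component_verts.mp v.2).1⟩, (mem_component_verts.mp v.2).2⟩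
  left_inv _ := rfl
  right_inv _ := rfl

theorem component_connected (H : Substructure G) (c : H.graph.ConnectedComponent) :
    (H.component c).graph.Connected := by
  refine c.connected_toSimpleGraph.map ⟨H.componentVertsEquiv c, fun {u v} huv => ?_⟩
    (H.componentVertsEquiv c).surjective
  rcases huv with h | h
  · exact Or.inl (mem_component_edges.mpr ⟨h, u.1, u.2, Or.inl rfl⟩)
  · exact Or.inr (mem_component_edges.mpr ⟨h, u.1, u.2, Or.inr rfl⟩)

theorem component_edges_incident (H : Substructure G) (c : H.graph.ConnectedComponent) :
    ∀ e ∈ (H.component c).edges,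
      e.1 ∈ (H.component c).verts ∨ e.2 ∈ (H.component c).verts := by
  intro e he
  obtain ⟨-, x, hx, h⟩ := mem_component_edges.mp he
  have hx' : (x : V) ∈ (H.component c).verts := mem_component_verts.mpr ⟨x.2, hx⟩
  rcases h with h | h
  · exact Or.inl (h ▸ hx')
  · exact Or.inr (h ▸ hx')

theorem laplacian_component [DecidableEq V] (H : Substructure G) (c : H.graph.ConnectedComponent)
    (ω : ℂ) : (H.component c).laplacian ω =
      (H.laplacian ω).submatrix (fun v => ((H.componentVertsEquiv c).symm v : H.verts))
        (fun v => ((H.componentVertsEquiv c).symm v : H.verts)) := by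
  have hsupp : ∀ v : (H.component c).verts,
      ((H.componentVertsEquiv c).symm v : H.verts) ∈ c.supp :=
    fun v => ((H.componentVertsEquiv c).symm v).2
  have hedge : ∀ (e : V × V) (v : (H.component c).verts), e.1 = v ∨ e.2 = v →
      (e ∈ (H.component c).edges ↔ e ∈ H.edges) := fun e v h =>
    ⟨fun he => (mem_component_edges.mp he).1,
      fun he => mem_component_edges.mpr ⟨he, _, hsupp v, h⟩⟩
  have hdeg : ∀ v : (H.component c).verts, (H.component c).deg v = H.deg v := by
    intro v
    rw [deg, deg]
    congr 1
    ext e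
    simp only [Finset.mem_filter]
    exact and_congr_left fun h => hedge e v h
  ext u v
  have h1 := hedge ((u : V), (v : V)) u (Or.inl rfl)
  have h2 := hedge ((v : V), (u : V)) v (Or.inl rfl)
  have h3 : ((H.componentVertsEquiv c).symm u : H.verts) = (H.componentVertsEquiv c).symm v ↔
      u = v := by
    rw [← Subtype.ext_iff, (H.componentVertsEquiv c).symm.injective.eq_iff]
  simp only [laplacian, Matrix.of_apply, Matrix.submatrix_apply, h1, h2, h3, hdeg]
  rfl

/-- The Hermitian Laplacian is block diagonal with respect to the connected components. -/
theorem det_laplacian_eq_prod_component [DecidableEq V] (H : Substructure G)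
    [Fintype H.graph.ConnectedComponent] (ω : ℂ) :
    (H.laplacian ω).det = ∏ c, ((H.component c).laplacian ω).det := by
  classical
  -- The factorization of block triangular determinants asks for some linear order on the blocks.
  let : LinearOrder H.graph.ConnectedComponent :=
    LinearOrder.lift' (Fintype.equivFin _) (Fintype.equivFin _).injective
  have hblock : (H.laplacian ω).BlockTriangular H.graph.connectedComponentMk := by
    intro u v huv
    have hadj : ¬ H.graph.Adj u v :=
      fun h => huv.ne' (SimpleGraph.ConnectedComponent.sound h.reachable)
    have hne : u ≠ v := by
      rintro rfl
      exact huv.ne rfl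
    have h1 : ((u : V), (v : V)) ∉ H.edges := fun h => hadj (Or.inl h)
    have h2 : ((v : V), (u : V)) ∉ H.edges := fun h => hadj (Or.inr h)
    simp [laplacian, hne, h1, h2]
  rw [hblock.det_fintype]
  refine Finset.prod_congr (by congr) fun c _ => ?_
  let ψ : (H.component c).verts ≃ {v // H.graph.connectedComponentMk v = c} :=
    (H.componentVertsEquiv c).symm
  rw [laplacian_component, ← Matrix.det_submatrix_equiv_self ψ]
  rfl

end Substructure

/-! ### The product over the roots of unity -/

theorem norm_omegaRoot (r : ℝ) : ‖omegaRoot r‖ = 1 := by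
  rw [omegaRoot, show Complex.I * 2 * Real.pi / r = ((2 * Real.pi / r : ℝ) : ℂ) * Complex.I by
    push_cast; ring]
  exact Complex.norm_exp_ofReal_mul_I _

theorem omegaRoot_div (p q : ℕ) :
    omegaRoot ((p : ℝ) / (q : ℝ)) = Complex.exp (2 * Real.pi * Complex.I / p) ^ q := by
  rw [omegaRoot, ← Complex.exp_nat_mul]
  congr 1
  push_cast
  rw [div_div_eq_mul_div]
  ring

/-- For an odd prime `p` and `p ∤ n`, the factors `|1 - ω^n|²` multiply to `p`, since `ω^n` runs
through one of each pair of conjugate primitive `p`-th roots of unity. -/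
theorem prod_omegaRoot {p : ℕ} (hp : p.Prime) (hodd : Odd p) {n : ℤ} (hn : ¬ (p : ℤ) ∣ n) :
    ∏ q ∈ Finset.Icc 1 ((p - 1) / 2), (1 - omegaRoot ((p : ℝ) / (q : ℝ)) ^ n) *
      (1 - (omegaRoot ((p : ℝ) / (q : ℝ)) ^ n)⁻¹) = p := by
  have hζ := Complex.isPrimitiveRoot_exp p hp.ne_zero
  have hcop : IsCoprime n (p : ℤ) :=
    ((Nat.prime_iff_prime_int.mp hp).coprime_iff_not_dvd.mpr hn).symm
  have hμ : IsPrimitiveRoot (Complex.exp (2 * Real.pi * Complex.I / p) ^ n) p :=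
    hζ.zpow_of_gcd_eq_one n (Int.isCoprime_iff_gcd_eq_one.mp hcop)
  obtain ⟨m, rfl⟩ := hodd
  have hm : (2 * m + 1 - 1) / 2 = m := by omega
  rw [hm, ← hμ.prod_one_sub_mul_one_sub_inv]
  refine Finset.prod_congr rfl fun q _ => ?_
  rw [omegaRoot_div, ← zpow_natCast, ← zpow_natCast, zpow_comm]

theorem mainTheorem1 {V : Type*} [DecidableEq V] (G : OrientedGraph V) (H : Substructure G)
    (hH : H.IsAllRegular) (p : ℕ) (hp : p.Prime) (hodd : Odd p)
    (hvan : ∀ c : H.graph.ConnectedComponent, ¬ (H.component c).IsVanishingUnicyclic p) :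
    (∏ q ∈ Finset.Icc 1 ((p - 1) / 2), (H.laplacian (omegaRoot ((p : ℝ) / (q : ℝ)))).det
        = (p : ℂ) ^ H.numNonVanishing p) ∧
      (H.numNonVanishing p : ℝ)
        = Real.logb p
          (∏ q ∈ Finset.Icc 1 ((p - 1) / 2),
            (H.laplacian (omegaRoot ((p : ℝ) / (q : ℝ)))).det).re := by
  classical
  let : Fintype H.graph.ConnectedComponent := Fintype.ofFinite _
  have hcomp : ∀ c : H.graph.ConnectedComponent,
      ∏ q ∈ Finset.Icc 1 ((p - 1) / 2),
        ((H.component c).laplacian (omegaRoot ((p : ℝ) / (q : ℝ)))).det =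
      if (H.component c).IsNonVanishingUnicyclic p then (p : ℂ) else 1 := by
    intro c
    rcases (H.component c).det_laplacian_of_connected (H.component_connected c) (hH c)
      (H.component_edges_incident c) with ⟨hU, hdet⟩ | ⟨hU, n, hcycle, hdet⟩
    · rw [if_neg fun h => hU h.1]
      exact Finset.prod_eq_one fun q _ => hdet _ (norm_omegaRoot _)
    · obtain ⟨_, ⟨v, w, hw, -⟩, -⟩ := hU.2.2
      have hdvd : ¬ (p : ℤ) ∣ (w.length : ℤ) - 2 * ((H.component c).numNegative w : ℤ) :=
        fun h => hvan c ⟨hU, v, w, hw, h⟩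
      rw [if_pos ⟨hU, v, w, hw, hdvd⟩]
      rw [hcycle v w hw, dvd_abs] at hdvd
      rw [← prod_omegaRoot hp hodd hdvd]
      exact Finset.prod_congr rfl fun q _ => hdet _ (norm_omegaRoot _)
  have hmain : ∏ q ∈ Finset.Icc 1 ((p - 1) / 2),
      (H.laplacian (omegaRoot ((p : ℝ) / (q : ℝ)))).det = (p : ℂ) ^ H.numNonVanishing p := by
    simp only [H.det_laplacian_eq_prod_component]
    rw [Finset.prod_comm, Finset.prod_congr rfl fun c _ => hcomp c, Finset.prod_ite,
      Finset.prod_const, Finset.prod_const_one, mul_one, Substructure.numNonVanishing,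
      ← Set.ncard_coe_finset]
    simp
  refine ⟨hmain, ?_⟩
  rw [hmain, ← Nat.cast_pow, Complex.natCast_re, Nat.cast_pow, Real.logb_pow,
    Real.logb_self_eq_one (by exact_mod_cast hp.one_lt), mul_one]
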